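/- For a finite simple graph $G$, let $\rho(G)$ be its spectral radius, i.e. the largest modulus of an eigenvalue of its adjacency matrix. Write $G\lor H$ for the join and $G+H$ for the disjoint union of graphs, and $mK_1$ for the edgeless graph on $m$ vertices. For $e\in\mathbb{N}$, let $k=k_e$ be the largest natural number with $\binom{k}{2}\le e$ and let $t=t_e=e-\binom{k}{2}$. For $e\ge 4$ and $n\ge e+2$ (so that $n\ge k+2$), let \[ \mathcal{D}_{n,e}=\bigl(((K_{k-t}+K_1)\lor K_t)+(n-k-2)K_1\bigr)\lor K_1,\qquad \mathcal{V}_{n,e}=\bigl(K_{1,e}+(n-e-2)K_1\bigr)\lor K_1, \] and let \begin{align*} \Psi_e(\lambda)={}&\lambda^3(k-1)(k-2)(k^2-3k+4t)\\ &-\lambda^2\bigl(k^5-6k^4+k^3(4t+15)-k^2(20t+18)+k(8t^2+24t+8)-(4t^2+12t)\bigr)\\ &-\lambda(k^2-k+2t)\bigl(k^3+k^2(t-4)-k(3t-5)+(4t^2-2t-2)\bigr)\\ &+t(k-t-1)(k^2-3k+2t)(k^2-k+2t). \end{align*} **Proposition.** Let $e\ge 4$ and $n\ge e+2$ be integers.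 Then $\Psi_e$ is a polynomial of degree $3$ in $\lambda$, so that it has a largest real root $\psi_e$, and exactly one of the following three statements holds: 1. $\rho(\mathcal{V}_{n,e})<\rho(\mathcal{D}_{n,e})<\psi_e$; 2. $\rho(\mathcal{V}_{n,e})=\rho(\mathcal{D}_{n,e})=\psi_e$; 3. $\rho(\mathcal{V}_{n,e})>\rho(\mathcal{D}_{n,e})>\psi_e$. -/

import Mathlib

/-- The join `G ∨ H`: the disjoint union of `G` and `H` together with all edges between them. -/
def graphJoin {V W : Type*} (G : SimpleGraph V) (H : SimpleGraph W) : SimpleGraph (V ⊕ W) :=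
  SimpleGraph.sum G H ⊔ completeBipartiteGraph V W

open Classical in
/-- The spectral radius of a finite graph: the largest modulus of an eigenvalue of its adjacency
matrix. (The adjacency matrix is real symmetric, so its eigenvalues are all real.) -/
noncomputable def graphRho {V : Type*} [Fintype V] (G : SimpleGraph V) : ℝ :=
  (spectralRadius ℝ (G.adjMatrix ℝ)).toReal

/-- `k_e`: the largest natural number `k` such that `k.choose 2 ≤ e`. -/
def kOf (e : ℕ) : ℕ := Nat.findGreatest (fun k => k.choose 2 ≤ e) (e + 1)

/-- The search bound in the definition of `kOf` is harmless. -/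
theorem kOf_isGreatest (e : ℕ) : IsGreatest {k : ℕ | k.choose 2 ≤ e} (kOf e) := by
  constructor
  · exact Nat.findGreatest_spec (P := fun k => k.choose 2 ≤ e) (Nat.zero_le _) (by simp)
  · intro k hk
    refine Nat.le_findGreatest ?_ hk
    have hk' : k.choose 2 ≤ e := hk
    rcases k with _ | j
    · exact Nat.zero_le _
    · have h : (j + 1).choose 2 = j + j.choose 2 := by
        rw [Nat.choose_succ_succ' j 1, Nat.choose_one_right]
      omega

/-- `t_e = e - k_e.choose 2`. -/
def tOf (e : ℕ) : ℕ := e - (kOf e).choose 2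

/-- The graph `D_{n,e} = (((K_{k-t} + K_1) ∨ K_t) + (n - k - 2) K_1) ∨ K_1` with `k = k_e`,
`t = t_e`. It has `n` vertices when `n ≥ k_e + 2`, the only range where it is used. -/
def graphD (n e : ℕ) :
    SimpleGraph ((((Fin (kOf e - tOf e) ⊕ Fin 1) ⊕ Fin (tOf e)) ⊕ Fin (n - kOf e - 2)) ⊕ Fin 1) :=
  graphJoin
    (SimpleGraph.sum
      (graphJoin
        (SimpleGraph.sum (SimpleGraph.completeGraph (Fin (kOf e - tOf e)))
          (SimpleGraph.completeGraph (Fin 1)))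
        (SimpleGraph.completeGraph (Fin (tOf e))))
      (SimpleGraph.emptyGraph (Fin (n - kOf e - 2))))
    (SimpleGraph.completeGraph (Fin 1))

/-- The graph `V_{n,e} = (K_{1,e} + (n - e - 2) K_1) ∨ K_1`, on `n` vertices when `n ≥ e + 2`. -/
def graphV (n e : ℕ) : SimpleGraph (((Fin 1 ⊕ Fin e) ⊕ Fin (n - e - 2)) ⊕ Fin 1) :=
  graphJoin
    (SimpleGraph.sum (completeBipartiteGraph (Fin 1) (Fin e))
      (SimpleGraph.emptyGraph (Fin (n - e - 2))))
    (SimpleGraph.completeGraph (Fin 1))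

open Polynomial in
/-- The polynomial `Ψ_e` with parameters `k = k_e`, `t = t_e`. -/
noncomputable def PsiPoly (e : ℕ) : ℝ[X] :=
  let k : ℝ := kOf e
  let t : ℝ := tOf e
  C ((k - 1) * (k - 2) * (k ^ 2 - 3 * k + 4 * t)) * X ^ 3
  - C (k ^ 5 - 6 * k ^ 4 + k ^ 3 * (4 * t + 15) - k ^ 2 * (20 * t + 18)
        + k * (8 * t ^ 2 + 24 * t + 8) - (4 * t ^ 2 + 12 * t)) * X ^ 2
  - C ((k ^ 2 - k + 2 * t)
        * (k ^ 3 + k ^ 2 * (t - 4) - k * (3 * t - 5) + (4 * t ^ 2 - 2 * t - 2))) * X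
  + C (t * (k - t - 1) * (k ^ 2 - 3 * k + 2 * t) * (k ^ 2 - k + 2 * t))

/-- `ψ_e`: the largest real root of `Ψ_e`. -/
noncomputable def psiRoot (e : ℕ) : ℝ := sSup {x : ℝ | (PsiPoly e).IsRoot x}

/-! Let r and s be the spectral radii of `graphD` and `graphV`. Positive eigenvectors constant on
the cells of each graph show that s is a root of a quartic and r > k a root of a quintic, both
affine in n. Evaluating the quartic at r and eliminating n by the equation of r leaves -Ψ(r)/4
divided by a positive number (`quarticV_mul_denomD`). The quartic at r has the sign of r - s
(`quarticV_factor`), and Ψ(r) has that of r - ψ (`isGreatest_psiRoot`), so r - s and ψ - r have the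
same sign. -/

open Classical in
/-- A positive eigenvector of the adjacency matrix belongs to the spectral radius. -/
theorem graphRho_eq_of_pos_eigenvector {V : Type*} [Fintype V] [Nonempty V] (G : SimpleGraph V)
    (x : V → ℝ) (lam : ℝ) (hx : ∀ v, 0 < x v)
    (h : ∀ v, ∑ w, (if G.Adj v w then x w else 0) = lam * x v) : graphRho G = lam := by
  have hlam : 0 ≤ lam := by
    obtain ⟨v⟩ := ‹Nonempty V›
    have h1 : 0 ≤ lam * x v := by
      rw [← h v]
      exact Finset.sum_nonneg fun w _ => by split_ifs <;> [exact (hx w).le; exact le_rfl]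
    exact nonneg_of_mul_nonneg_left h1 (hx v)
  have hmem : lam ∈ spectrum ℝ (G.adjMatrix ℝ) := by
    rw [← Matrix.spectrum_toLin']
    refine Module.End.HasEigenvalue.mem_spectrum
      (Module.End.hasEigenvalue_of_hasEigenvector (x := x) ⟨?_, ?_⟩)
    · rw [Module.End.mem_eigenspace_iff, Matrix.toLin'_apply]
      ext v
      rw [Pi.smul_apply, smul_eq_mul, ← h v]
      simp [Matrix.mulVec, dotProduct, SimpleGraph.adjMatrix_apply]
    · obtain ⟨v⟩ := ‹Nonempty V›
      intro h0
      have := hx v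
      rw [h0] at this
      exact lt_irrefl _ this
  have hbound : ∀ mu ∈ spectrum ℝ (G.adjMatrix ℝ), |mu| ≤ lam := by
    intro mu hmu
    rw [← Matrix.spectrum_toLin'] at hmu
    obtain ⟨y, hy⟩ := (Module.End.hasEigenvalue_iff_mem_spectrum.mpr hmu).exists_hasEigenvector
    have hy1 : ∀ v, ∑ w, (if G.Adj v w then y w else 0) = mu * y v := by
      intro v
      have := congrFun hy.apply_eq_smul v
      rw [Matrix.toLin'_apply, Pi.smul_apply, smul_eq_mul] at this
      rw [← this]
      simp [Matrix.mulVec, dotProduct, SimpleGraph.adjMatrix_apply]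
    -- At a vertex maximising |y|/x, the equation for y is dominated by the one for x.
    obtain ⟨i, hi⟩ := Finite.exists_max fun v => |y v| / x v
    have hle : ∀ v, |y v| ≤ |y i| / x i * x v := fun v => (div_le_iff₀ (hx v)).mp (hi v)
    have hyi : 0 < |y i| := by
      by_contra hcon
      have h0 : |y i| = 0 := le_antisymm (not_lt.mp hcon) (abs_nonneg _)
      refine hy.2 (funext fun v => ?_)
      have := hle v
      rw [h0, zero_div, zero_mul] at this
      exact abs_eq_zero.mp (le_antisymm this (abs_nonneg _))
    have key : |mu| * |y i| ≤ lam * |y i| := by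
      calc |mu| * |y i| = |∑ w, (if G.Adj i w then y w else 0)| := by rw [hy1, abs_mul]
        _ ≤ ∑ w, |if G.Adj i w then y w else 0| := Finset.abs_sum_le_sum_abs _ _
        _ ≤ ∑ w, |y i| / x i * (if G.Adj i w then x w else 0) := by
            refine Finset.sum_le_sum fun w _ => ?_
            split_ifs
            · exact hle w
            · simp
        _ = lam * |y i| := by
            rw [← Finset.mul_sum, h i]
            field_simp [(hx i).ne']
    exact le_of_mul_le_mul_right key hyi
  have hrad : spectralRadius ℝ (G.adjMatrix ℝ) = ENNReal.ofReal lam := by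
    refine le_antisymm (iSup₂_le fun mu hmu => ?_) ?_
    · rw [← enorm_eq_nnnorm, ← ofReal_norm, Real.norm_eq_abs]
      exact ENNReal.ofReal_le_ofReal (hbound mu hmu)
    · refine le_trans (le_of_eq ?_) (le_iSup₂ (f := fun mu _ => (‖mu‖₊ : ENNReal)) lam hmem)
      rw [← enorm_eq_nnnorm, ← ofReal_norm, Real.norm_eq_abs, abs_of_nonneg hlam]
  rw [graphRho, hrad, ENNReal.toReal_ofReal hlam]

theorem sum_ite_ne_const (m : ℕ) (v : Fin m) (c : ℝ) :
    ∑ w : Fin m, (if v = w then 0 else c) = (m - 1) * c := by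
  have h : ∀ w : Fin m, (if v = w then 0 else c) = c - if v = w then c else 0 := fun w => by
    split_ifs <;> simp
  rw [Finset.sum_congr rfl fun w _ => h w, Finset.sum_sub_distrib]
  simp
  ring

theorem exists_ge_eval_nonneg (p : Polynomial ℝ) (hd : 0 < p.natDegree)
    (hl : 0 < p.leadingCoeff) (K : ℝ) : ∃ M, K ≤ M ∧ 0 ≤ p.eval M :=
  ((Filter.eventually_ge_atTop K).and ((p.tendsto_atTop_of_leadingCoeff_nonneg
    (Polynomial.natDegree_pos_iff_degree_pos.mp hd) hl.le).eventually_ge_atTop 0)).exists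

theorem exists_root_ge (p : Polynomial ℝ) (hd : 0 < p.natDegree) (hl : 0 < p.leadingCoeff)
    {K : ℝ} (hK : p.eval K < 0) : ∃ z, K < z ∧ p.eval z = 0 := by
  obtain ⟨M, hKM, hM⟩ := exists_ge_eval_nonneg p hd hl K
  obtain ⟨z, hz, hz0⟩ := intermediate_value_Icc hKM p.continuous.continuousOn ⟨hK.le, hM⟩
  refine ⟨z, lt_of_le_of_ne hz.1 ?_, hz0⟩
  rintro rfl
  exact hK.ne hz0

/-! ### Positive eigenvectors of the two graphs -/

/-- The quartic whose largest root is the spectral radius of `graphV`, with `m` isolated vertices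
before the final join. -/
def quarticV (e m x : ℝ) : ℝ :=
  x ^ 2 * (x ^ 2 - e) - x * ((e + 1) * x + 2 * e) - m * (x ^ 2 - e)

/-- The denominator of the walk generating function of the core of `graphD`, with `a = k - t`. -/
def denomD (a t x : ℝ) : ℝ :=
  x * (x - a + 1) * (x - t + 1) - t * (a * x + x - a + 1)

/-- The numerator of the walk generating function of the core of `graphD`, with `a = k - t`. -/
def numerD (a t x : ℝ) : ℝ :=
  a * x * (x + 1) + (x + 1) * (x - a + 1) + t * (x ^ 2 + 2 * x + 1 - a)

theorem graphRho_graphV {n e : ℕ} {s : ℝ} (hn : e + 2 ≤ n) (hs : 0 < s) (hse : (e : ℝ) < s ^ 2)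
    (hroot : quarticV e (n - e - 2) s = 0) : graphRho (graphV n e) = s := by
  have hm : ((n - e - 2 : ℕ) : ℝ) = n - e - 2 := by
    rw [Nat.sub_sub, Nat.cast_sub hn]; push_cast; ring
  have he : (0 : ℝ) ≤ e := Nat.cast_nonneg e
  have hd : 0 < s ^ 2 - e := by linarith
  unfold quarticV at hroot
  -- One value per cell, denominators cleared: only the equation at the cone vertex needs `hroot`.
  refine graphRho_eq_of_pos_eigenvector _
    (Sum.elim (Sum.elim (Sum.elim (fun _ => s * (s + e)) (fun _ => s * (s + 1)))
      (fun _ => s ^ 2 - e)) (fun _ => s * (s ^ 2 - e))) s ?_ ?_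
  · rintro (((v | v) | v) | v) <;> simp only [Sum.elim_inl, Sum.elim_inr] <;> positivity
  · rintro (((v | v) | v) | v)
    · simp [graphV, graphJoin, completeBipartiteGraph]
      ring
    · simp [graphV, graphJoin, completeBipartiteGraph]
      ring
    · simp [graphV, graphJoin, completeBipartiteGraph]
    · simp [graphV, graphJoin, completeBipartiteGraph, hm, Subsingleton.elim v 0]
      linear_combination -hroot

theorem graphRho_graphD {n e : ℕ} {r : ℝ} (hn : kOf e + 2 ≤ n) (ht : tOf e < kOf e)
    (hr : (kOf e : ℝ) ≤ r)
    (hh : 0 < denomD (kOf e - tOf e) (tOf e) r)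
    (hroot : r ^ 2 * denomD (kOf e - tOf e) (tOf e) r = r * numerD (kOf e - tOf e) (tOf e) r
      + (n - kOf e - 2) * denomD (kOf e - tOf e) (tOf e) r) : graphRho (graphD n e) = r := by
  have hm : ((n - kOf e - 2 : ℕ) : ℝ) = n - kOf e - 2 := by
    rw [Nat.sub_sub, Nat.cast_sub hn]; push_cast; ring
  have ha : ((kOf e - tOf e : ℕ) : ℝ) = kOf e - tOf e := Nat.cast_sub ht.le
  have hk : (1 : ℝ) ≤ kOf e := by exact_mod_cast (by omega : 1 ≤ kOf e)
  have ht0 : (0 : ℝ) ≤ tOf e := Nat.cast_nonneg _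
  have hr0 : 0 < r := by linarith
  generalize hA : (kOf e : ℝ) - tOf e = a at *
  have har : a ≤ r := by linarith
  have h1 : 0 < r - a + 1 := by linarith
  have h2 : 0 < r ^ 2 + 2 * r + 1 - a := by nlinarith
  generalize hH : denomD a (tOf e) r = H at *
  -- With rH on the cone vertex, the other cells solve their own equations; the cone vertex gives
  -- `hroot`.
  refine graphRho_eq_of_pos_eigenvector _
    (Sum.elim (Sum.elim (Sum.elim (Sum.elim (fun _ => r * (r * (r + 1)))
      (fun _ => r * ((r + 1) * (r - a + 1)))) (fun _ => r * (r ^ 2 + 2 * r + 1 - a)))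
      (fun _ => H)) (fun _ => r * H)) r ?_ ?_
  · rintro ((((v | v) | v) | v) | v) <;> simp only [Sum.elim_inl, Sum.elim_inr] <;> positivity
  · unfold denomD at hH
    unfold numerD at hroot
    rintro ((((v | v) | v) | v) | v)
    · simp [graphD, graphJoin, completeBipartiteGraph, sum_ite_ne_const, ha]
      subst hH
      ring
    · simp [graphD, graphJoin, completeBipartiteGraph, Subsingleton.elim v 0]
      subst hH
      ring
    · simp [graphD, graphJoin, completeBipartiteGraph, sum_ite_ne_const, ha]
      subst hH
      ring
    · simp [graphD, graphJoin, completeBipartiteGraph]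
    · simp [graphD, graphJoin, completeBipartiteGraph, ha, hm, Subsingleton.elim v 0]
      linear_combination -hroot

/-! ### The parameters k, t and the cubic Ψ -/

theorem kOf_tOf_spec {e : ℕ} (he : 4 ≤ e) : 3 ≤ kOf e ∧ tOf e < kOf e ∧ kOf e ≤ e ∧
    (kOf e = 3 → 1 ≤ tOf e) ∧ (e : ℝ) = kOf e * (kOf e - 1) / 2 + tOf e := by
  obtain ⟨h1, h2⟩ := kOf_isGreatest e
  have h1 : (kOf e).choose 2 ≤ e := h1
  have h3 : 3 ≤ kOf e := h2 (show (3 : ℕ).choose 2 ≤ e by simpa [Nat.choose] using by omega)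
  have h4 : e < (kOf e + 1).choose 2 := by
    by_contra hcon
    have := h2 (show kOf e + 1 ∈ {k : ℕ | k.choose 2 ≤ e} from not_lt.mp hcon)
    omega
  have h5 : (kOf e + 1).choose 2 = kOf e + (kOf e).choose 2 := by
    rw [Nat.choose_succ_succ' _ 1, Nat.choose_one_right]
  have h6 : e = (kOf e).choose 2 + tOf e := by unfold tOf; omega
  have h7 : kOf e ≤ (kOf e).choose 2 := by
    rw [Nat.choose_two_right, Nat.le_div_iff_mul_le two_pos]
    exact Nat.mul_le_mul_left _ (by omega)
  refine ⟨h3, by omega, by omega, fun h => ?_, ?_⟩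
  · rw [h] at h6
    have : (3 : ℕ).choose 2 = 3 := rfl
    omega
  · have := congrArg (Nat.cast (R := ℝ)) h6
    rw [Nat.cast_add, Nat.cast_choose_two] at this
    exact this

/-- The value of the polynomial `Ψ` with parameters `k`, `t`. -/
def psiVal (k t x : ℝ) : ℝ :=
  (k - 1) * (k - 2) * (k ^ 2 - 3 * k + 4 * t) * x ^ 3
  - (k ^ 5 - 6 * k ^ 4 + k ^ 3 * (4 * t + 15) - k ^ 2 * (20 * t + 18)
        + k * (8 * t ^ 2 + 24 * t + 8) - (4 * t ^ 2 + 12 * t)) * x ^ 2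
  - (k ^ 2 - k + 2 * t)
        * (k ^ 3 + k ^ 2 * (t - 4) - k * (3 * t - 5) + (4 * t ^ 2 - 2 * t - 2)) * x
  + t * (k - t - 1) * (k ^ 2 - 3 * k + 2 * t) * (k ^ 2 - k + 2 * t)

theorem eval_PsiPoly (e : ℕ) (x : ℝ) : (PsiPoly e).eval x = psiVal (kOf e) (tOf e) x := by
  simp [PsiPoly, psiVal]

theorem leading_pos {e : ℕ} (he : 4 ≤ e) : (0 : ℝ) <
    ((kOf e : ℝ) - 1) * (kOf e - 2) * (kOf e ^ 2 - 3 * kOf e + 4 * tOf e) := by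
  obtain ⟨h3, -, -, h4, -⟩ := kOf_tOf_spec he
  have hk : (3 : ℝ) ≤ kOf e := by exact_mod_cast h3
  have ht : (0 : ℝ) ≤ tOf e := Nat.cast_nonneg _
  refine mul_pos (mul_pos (by linarith) (by linarith)) ?_
  -- For k = 3 the term k² - 3k vanishes, and positivity rests on t ≥ 1.
  rcases h3.eq_or_lt with h | h
  · have : (1 : ℝ) ≤ tOf e := by exact_mod_cast h4 h.symm
    nlinarith
  · have : (4 : ℝ) ≤ kOf e := by exact_mod_cast h
    nlinarith

open Polynomial in
theorem natDegree_cubic_sub {A : ℝ} (hA : A ≠ 0) (B D E : ℝ) :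
    (C A * X ^ 3 - C B * X ^ 2 - C D * X + C E).natDegree = 3 := by
  compute_degree!

theorem natDegree_PsiPoly {e : ℕ} (he : 4 ≤ e) : (PsiPoly e).natDegree = 3 :=
  natDegree_cubic_sub (leading_pos he).ne' _ _ _

open Polynomial in
theorem coeff_three_cubic_sub (A B D E : ℝ) :
    (C A * X ^ 3 - C B * X ^ 2 - C D * X + C E).coeff 3 = A := by
  simp [coeff_X_pow]

theorem leadingCoeff_PsiPoly {e : ℕ} (he : 4 ≤ e) : 0 < (PsiPoly e).leadingCoeff := by
  rw [Polynomial.leadingCoeff, natDegree_PsiPoly he]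
  exact (leading_pos he).trans_eq (coeff_three_cubic_sub _ _ _ _).symm

theorem psiVal_zero_nonneg {k t : ℝ} (hk : 3 ≤ k) (ht : 0 ≤ t) (htk : t ≤ k - 1) :
    0 ≤ psiVal k t 0 := by
  have h1 : 0 ≤ k - t - 1 := by linarith
  have h2 : 0 ≤ k ^ 2 - 3 * k + 2 * t := by nlinarith
  have h3 : 0 ≤ k ^ 2 - k + 2 * t := by nlinarith
  have : psiVal k t 0 = t * (k - t - 1) * (k ^ 2 - 3 * k + 2 * t) * (k ^ 2 - k + 2 * t) := by
    unfold psiVal; ring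
  rw [this]
  positivity

/-- With k = t + 1 + s, and t shifted when s is 0 or 1, -Ψ(k) expands with nonnegative coefficients
and a positive constant term. -/
theorem psiVal_self_neg {k t : ℕ} (hk : 3 ≤ k) (htk : t < k) : psiVal k t k < 0 := by
  obtain ⟨s, rfl⟩ : ∃ s, k = t + 1 + s := ⟨k - t - 1, by omega⟩
  rw [← neg_pos]
  rcases s with _ | _ | s
  · obtain ⟨u, rfl⟩ : ∃ u, t = u + 2 := ⟨t - 2, by omega⟩
    unfold psiVal
    push_cast
    ring_nf
    positivity
  · obtain ⟨u, rfl⟩ : ∃ u, t = u + 1 := ⟨t - 1, by omega⟩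
    unfold psiVal
    push_cast
    ring_nf
    positivity
  · unfold psiVal
    push_cast
    ring_nf
    positivity

/-- A real cubic with positive leading coefficient, nonnegative at `0` and negative at `K > 0`, has
the sign of `x - z` at every `x ≥ K`, where `z > K` is a root. -/
theorem cubic_factor {A B C D K z : ℝ} (hA : 0 < A) (hK : 0 < K) (hKz : K < z)
    (h0 : 0 ≤ D) (hneg : A * K ^ 3 - B * K ^ 2 - C * K + D < 0)
    (hz : A * z ^ 3 - B * z ^ 2 - C * z + D = 0) {x : ℝ} (hx : K ≤ x) :
    ∃ q, 0 < q ∧ A * x ^ 3 - B * x ^ 2 - C * x + D = (x - z) * q := by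
  have hQ : ∀ y, A * y ^ 3 - B * y ^ 2 - C * y + D
      = (y - z) * (A * y ^ 2 + (A * z - B) * y + (A * z ^ 2 - B * z - C)) := fun y => by
    linear_combination hz
  refine ⟨_, ?_, hQ x⟩
  -- The constant term of the quotient is -D/z.
  have hc : A * z ^ 2 - B * z - C ≤ 0 := by
    by_contra hcon
    have := mul_pos (hK.trans hKz) (not_le.mp hcon)
    nlinarith
  have hqK : 0 < A * K ^ 2 + (A * z - B) * K + (A * z ^ 2 - B * z - C) := by
    rw [hQ K] at hneg
    by_contra hcon
    have := mul_nonneg_of_nonpos_of_nonpos (sub_neg.mpr hKz).le (not_lt.mp hcon)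
    linarith
  have hx0 : 0 < x := hK.trans_le hx
  refine pos_of_mul_pos_right (a := K) ?_ hK.le
  -- For the quotient q with constant term c, K q(x) = x q(K) - c (x - K) + A K x (x - K).
  nlinarith [mul_pos hx0 hqK, mul_nonneg (sub_nonneg.mpr hx) (neg_nonneg.mpr hc),
    mul_nonneg (mul_nonneg hA.le (mul_pos hK hx0).le) (sub_nonneg.mpr hx)]

theorem isGreatest_psiRoot {e : ℕ} (he : 4 ≤ e) :
    IsGreatest {x : ℝ | (PsiPoly e).IsRoot x} (psiRoot e) ∧
      ∀ x : ℝ, kOf e ≤ x → ∃ q, 0 < q ∧ psiVal (kOf e) (tOf e) x = (x - psiRoot e) * q := by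
  obtain ⟨h3, htk, -, -, -⟩ := kOf_tOf_spec he
  have hk : (3 : ℝ) ≤ kOf e := by exact_mod_cast h3
  have ht : (tOf e : ℝ) ≤ kOf e - 1 := by
    have : ((tOf e + 1 : ℕ) : ℝ) ≤ kOf e := by exact_mod_cast htk
    push_cast at this
    linarith
  have hneg := psiVal_self_neg h3 htk
  have h0 := psiVal_zero_nonneg hk (Nat.cast_nonneg _) ht
  obtain ⟨z, hKz, hz⟩ := exists_root_ge (PsiPoly e) (by rw [natDegree_PsiPoly he]; norm_num)
    (leadingCoeff_PsiPoly he) (K := kOf e) (by rwa [eval_PsiPoly])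
  have hz' := hz
  rw [eval_PsiPoly] at hz'
  have hfac : ∀ x : ℝ, kOf e ≤ x →
      ∃ q, 0 < q ∧ psiVal (kOf e) (tOf e) x = (x - z) * q := by
    intro x hx
    unfold psiVal at h0 hneg hz' ⊢
    exact cubic_factor (leading_pos he) (by linarith) hKz (by simpa using h0) hneg hz' hx
  have hgr : IsGreatest {x : ℝ | (PsiPoly e).IsRoot x} z := by
    refine ⟨hz, fun x hx => ?_⟩
    by_contra hcon
    rw [not_le] at hcon
    obtain ⟨q, hq, hxq⟩ := hfac x (hKz.le.trans hcon.le)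
    have hx : (PsiPoly e).eval x = 0 := hx
    rw [eval_PsiPoly, hxq] at hx
    exact (mul_pos (sub_pos.mpr hcon) hq).ne' hx
  have : psiRoot e = z := hgr.csSup_eq
  rw [this]
  exact ⟨hgr, hfac⟩

/-! ### Existence of the roots r and s -/

theorem denomD_pos {k t x : ℝ} (ht : 0 ≤ t) (htk : t + 1 ≤ k) (hx : k ≤ x) :
    0 < denomD (k - t) t x := by
  obtain ⟨u, hu, rfl⟩ : ∃ u, 0 ≤ u ∧ x = k + u := ⟨x - k, by linarith, by ring⟩
  obtain ⟨b, hb, rfl⟩ : ∃ b, 0 ≤ b ∧ k = t + 1 + b := ⟨k - t - 1, by linarith, by ring⟩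
  unfold denomD
  ring_nf
  positivity

/-- This makes the quintic for `graphD` negative at k, whatever m ≥ 0 is, so it has a root beyond k.
-/
theorem numerD_gt {k t : ℝ} (ht : 0 ≤ t) (htk : t + 1 ≤ k) :
    k * denomD (k - t) t k < numerD (k - t) t k := by
  obtain ⟨b, hb, rfl⟩ : ∃ b, 0 ≤ b ∧ k = t + 1 + b := ⟨k - t - 1, by linarith, by ring⟩
  rw [← sub_pos]
  unfold denomD numerD
  ring_nf
  positivity

open Polynomial in
theorem exists_root_graphD {k t m : ℝ} (ht : 0 ≤ t) (htk : t + 1 ≤ k) (hm : 0 ≤ m) :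
    ∃ r, k < r ∧ r ^ 2 * denomD (k - t) t r
      = r * numerD (k - t) t r + m * denomD (k - t) t r := by
  obtain ⟨a, ha⟩ : ∃ a, a = k - t := ⟨_, rfl⟩
  have hh := denomD_pos ht htk le_rfl
  have hN := numerD_gt ht htk
  rw [← ha] at *
  let H : ℝ[X] := X * (X - C a + 1) * (X - C t + 1) - C t * (C a * X + X - C a + 1)
  let N : ℝ[X] := C a * X * (X + 1) + (X + 1) * (X - C a + 1)
    + C t * (X ^ 2 + 2 * X + 1 - C a)
  have hH : ∀ x, H.eval x = denomD a t x := fun x => by simp [H, denomD]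
  have hNe : ∀ x, N.eval x = numerD a t x := fun x => by simp [N, numerD]
  have hmon : H.Monic := by simp only [H]; monicity!
  have hHd : H.natDegree = 3 := by simp only [H]; compute_degree!
  have hNd : N.natDegree ≤ 2 := by simp only [N]; compute_degree
  have hmon2 : (X ^ 2 * H).Monic := (monic_X_pow 2).mul hmon
  have hd2 : (X ^ 2 * H).natDegree = 5 := by
    rw [(monic_X_pow 2).natDegree_mul hmon, hHd, natDegree_X_pow]
  have hlow : (X * N + C m * H).natDegree ≤ 4 := by
    refine (natDegree_add_le _ _).trans (max_le ?_ ?_)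
    · exact natDegree_mul_le.trans (by rw [natDegree_X]; omega)
    · exact (natDegree_C_mul_le _ _).trans (by omega)
  have hlt : (X * N + C m * H).degree < (X ^ 2 * H).degree :=
    degree_lt_degree (by omega)
  have hP := hmon2.sub_of_left hlt
  have hPd : (X ^ 2 * H - (X * N + C m * H)).natDegree = 5 := by
    rw [natDegree_sub_eq_left_of_natDegree_lt (by omega), hd2]
  obtain ⟨r, hr, hr0⟩ := exists_root_ge _ (by rw [hPd]; norm_num)
    (by rw [hP.leadingCoeff]; exact one_pos) (K := k) (by
      simp only [eval_sub, eval_add, eval_mul, eval_pow, eval_X, eval_C, hH, hNe]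
      have hk : 0 < k := by linarith
      nlinarith [mul_pos hk (sub_pos.mpr hN), mul_nonneg hm hh.le])
  refine ⟨r, hr, ?_⟩
  simp only [eval_sub, eval_add, eval_mul, eval_pow, eval_X, eval_C, hH, hNe] at hr0
  linarith

open Polynomial in
theorem exists_root_quarticV {e m : ℝ} (he : 0 < e) :
    ∃ s, 0 < s ∧ e < s ^ 2 ∧ quarticV e m s = 0 := by
  let p : ℝ[X] := X ^ 2 * (X ^ 2 - C e) - X * (C (e + 1) * X + 2 * C e) - C m * (X ^ 2 - C e)
  have hp : ∀ x, p.eval x = quarticV e m x := fun x => by simp [p, quarticV]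
  have hmon : p.Monic := by simp only [p]; monicity!
  have hd : p.natDegree = 4 := by simp only [p]; compute_degree!
  have hs := Real.sq_sqrt he.le
  have hs0 := Real.sqrt_pos.mpr he
  obtain ⟨s, hs1, hs2⟩ := exists_root_ge p (by omega) (by rw [hmon.leadingCoeff]; exact one_pos)
    (K := √e) (by
      rw [hp, quarticV, hs, sub_self, mul_zero, mul_zero, zero_sub, sub_zero, neg_lt_zero]
      positivity)
  exact ⟨s, hs0.trans hs1, (Real.lt_sq_of_sqrt_lt hs1), by rw [← hp, hs2]⟩

/-! ### Comparison of r, s and ψ -/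

/-- To the right of `√e` the quartic has the sign of `r - s`, where `s` is its root. -/
theorem quarticV_factor {e m r s : ℝ} (he : 0 ≤ e) (hm : 0 ≤ m) (hs : 0 < s) (hse : e < s ^ 2)
    (hroot : quarticV e m s = 0) (hr : 0 < r) (hre : e < r ^ 2) :
    ∃ q, 0 < q ∧ quarticV e m r = (r - s) * q := by
  have h1 : 0 < s ^ 2 - e := by linarith
  have h2 : 0 < r ^ 2 - e := by linarith
  -- Divided by x(x² - e), the quartic is x - ((e+1)x + 2e)/(x² - e) - m/x; the witness comes from
  -- its difference quotient between s and r.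
  refine ⟨(r * s * (r ^ 2 - e) * (s ^ 2 - e) + r * s * ((e + 1) * (r * s + e) + 2 * e * (r + s))
    + m * (r ^ 2 - e) * (s ^ 2 - e)) / (s * (s ^ 2 - e)), by positivity, ?_⟩
  rw [← mul_div_assoc, eq_div_iff (by positivity)]
  unfold quarticV at *
  linear_combination (r * (r ^ 2 - e)) * hroot

/-- The equation for r eliminates n. The terms of degree 5 and 4 in r then cancel, the latter
because 2e = k(k - 1) + 2t. -/
theorem quarticV_mul_denomD {k t e n r : ℝ} (he : e = k * (k - 1) / 2 + t)
    (hroot : r ^ 2 * denomD (k - t) t r = r * numerD (k - t) t r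
      + (n - k - 2) * denomD (k - t) t r) :
    quarticV e (n - e - 2) r * denomD (k - t) t r = -(psiVal k t r / 4) := by
  have h : quarticV e (n - e - 2) r * denomD (k - t) t r
      = (r ^ 2 - e) * (r * numerD (k - t) t r - (k + 1) * denomD (k - t) t r)
        - e * (2 * r + e + 1) * denomD (k - t) t r := by
    unfold quarticV
    linear_combination (r ^ 2 - e) * hroot
  rw [h, he]
  unfold denomD numerD psiVal
  ring

theorem mainTheorem4 (e n : ℕ) (he : 4 ≤ e) (hn : e + 2 ≤ n) :
    -- `Ψ_e` is a cubic, and `ψ_e` really is its largest real root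
    (PsiPoly e).natDegree = 3 ∧
    IsGreatest {x : ℝ | (PsiPoly e).IsRoot x} (psiRoot e) ∧
    -- exactly one of the three cases holds
    (((graphRho (graphV n e) < graphRho (graphD n e) ∧ graphRho (graphD n e) < psiRoot e) ∧
        ¬ (graphRho (graphV n e) = graphRho (graphD n e) ∧ graphRho (graphD n e) = psiRoot e) ∧
        ¬ (graphRho (graphV n e) > graphRho (graphD n e) ∧ graphRho (graphD n e) > psiRoot e)) ∨
      (¬ (graphRho (graphV n e) < graphRho (graphD n e) ∧ graphRho (graphD n e) < psiRoot e) ∧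
        (graphRho (graphV n e) = graphRho (graphD n e) ∧ graphRho (graphD n e) = psiRoot e) ∧
        ¬ (graphRho (graphV n e) > graphRho (graphD n e) ∧ graphRho (graphD n e) > psiRoot e)) ∨
      (¬ (graphRho (graphV n e) < graphRho (graphD n e) ∧ graphRho (graphD n e) < psiRoot e) ∧
        ¬ (graphRho (graphV n e) = graphRho (graphD n e) ∧ graphRho (graphD n e) = psiRoot e) ∧
        (graphRho (graphV n e) > graphRho (graphD n e) ∧ graphRho (graphD n e) > psiRoot e))) := by
  obtain ⟨h3, htk, hke, -, hcast⟩ := kOf_tOf_spec he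
  obtain ⟨hgr, hfac⟩ := isGreatest_psiRoot he
  refine ⟨natDegree_PsiPoly he, hgr, ?_⟩
  have hk : (3 : ℝ) ≤ kOf e := by exact_mod_cast h3
  have ht : (tOf e : ℝ) + 1 ≤ kOf e := by exact_mod_cast htk
  have ht0 : (0 : ℝ) ≤ tOf e := Nat.cast_nonneg _
  have hkn : kOf e + 2 ≤ n := by omega
  have hkn' : (0 : ℝ) ≤ n - kOf e - 2 := by
    have : ((kOf e + 2 : ℕ) : ℝ) ≤ n := by exact_mod_cast hkn
    push_cast at this
    linarith
  have hen : (0 : ℝ) ≤ n - e - 2 := by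
    have : ((e + 2 : ℕ) : ℝ) ≤ n := by exact_mod_cast hn
    push_cast at this
    linarith
  have he0 : (0 : ℝ) < e := by exact_mod_cast (by omega : 0 < e)
  obtain ⟨r, hkr, hr⟩ := exists_root_graphD ht0 ht hkn'
  obtain ⟨s, hs, hse, hsr⟩ := exists_root_quarticV (m := n - e - 2) he0
  have hh := denomD_pos ht0 ht hkr.le
  have hre : (e : ℝ) < r ^ 2 := by nlinarith
  rw [graphRho_graphV hn hs hse hsr, graphRho_graphD hkn htk hkr.le hh hr]
  obtain ⟨q, hq, hVq⟩ := quarticV_factor he0.le hen hs hse hsr (by linarith) hre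
  obtain ⟨p, hp, hPp⟩ := hfac r hkr.le
  have hkey := quarticV_mul_denomD hcast hr
  -- Now (r - s) q H = -(r - ψ) p / 4, where q, p and H (the value of `denomD`) are positive.
  rw [hVq, hPp] at hkey
  rcases lt_trichotomy r (psiRoot e) with h | h | h
  · have h1 : 0 < (r - s) * q * denomD (kOf e - tOf e) (tOf e) r := by
      rw [hkey]
      nlinarith [mul_pos (sub_pos.mpr h) hp]
    have h2 : s < r :=
      sub_pos.mp (pos_of_mul_pos_left (pos_of_mul_pos_left h1 hh.le) hq.le)
    exact Or.inl ⟨⟨h2, h⟩, fun h' => h.ne h'.2, fun h' => h.asymm h'.2⟩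
  · have h1 : (r - s) * (q * denomD (kOf e - tOf e) (tOf e) r) = 0 := by
      rw [← mul_assoc, hkey, h]
      ring
    have h2 : r = s :=
      sub_eq_zero.mp ((mul_eq_zero.mp h1).resolve_right (mul_pos hq hh).ne')
    exact Or.inr (Or.inl ⟨fun h' => h'.2.ne h, ⟨h2.symm, h⟩, fun h' => h'.2.ne' h⟩)
  · have h1 : 0 < (s - r) * q * denomD (kOf e - tOf e) (tOf e) r := by
      nlinarith [mul_pos (sub_pos.mpr h) hp]
    have h2 : r < s :=
      sub_pos.mp (pos_of_mul_pos_left (pos_of_mul_pos_left h1 hh.le) hq.le)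
    exact Or.inr (Or.inr ⟨fun h' => h.asymm h'.2, fun h' => h.ne' h'.2, h2, h⟩)
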